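/- Let $n\ge 1$, let $A\in\mathbb{R}^{n\times n}$ and $B\in\mathbb{R}^{n\times m}$ with $(A,B)$ controllable (i.e. $\operatorname{rank}[B, AB,\dots,A^{n-1}B]=n$), and let $Q\in\mathbb{R}^{n\times n}$ and $R\in\mathbb{R}^{m\times m}$ be symmetric positive definite. Let $\mathcal{G}=\{K\in\mathbb{R}^{m\times n} : A-BK \text{ is Hurwitz}\}$ be the set of stabilizing gains (Hurwitz: all eigenvalues have negative real part). For every $K\in\mathcal{G}$ the Lyapunov equation $$P_K(A-BK)+(A-BK)^\top P_K+K^\top RK+Q=0$$ has a unique solution $P_K\in\mathbb{R}^{n\times n}$, and the continuous-time LQR cost $J(K)=\operatorname{tr}(P_K)$ is differentiable on $\mathcal{G}$. Let $\nabla J$ be its gradient with respect to the Euclidean (Frobenius) inner product on $\mathbb{R}^{m\times n}$ and $\|\cdot\|$ the associated norm. Then $J$ never satisfies a global Polyak–Łojasiewicz inequality: there is no $\mu>0$ such that $$\|\nabla J(K)\|\ \ge\ \sqrt{\mu\,\bigl(J(K)-\underline J\bigr)}\qquad\text{for all } K\in\mathcal{G},$$ where $\underline J=\inf_{K\in\mathcal{G}}J(K)$.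 In particular, for any minimizer $K^*\in\mathcal{G}$ of $J$ over $\mathcal{G}$, there is no $\mu>0$ such that $\|\nabla J(K)\|\ge\sqrt{\mu\,(J(K)-J(K^*))}$ for all $K\in\mathcal{G}$. -/

import Mathlib

namespace CTLQR

open Matrix

/-- A real square matrix is Hurwitz if all its complex eigenvalues have negative real part. -/
def IsHurwitz {n : ℕ} (M : Matrix (Fin n) (Fin n) ℝ) : Prop :=
  ∀ z ∈ spectrum ℂ (M.map (algebraMap ℝ ℂ)), z.re < 0

/-- The controllability matrix `[B, AB, …, A^(n-1)B]`; its columns are indexed by pairs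
(power of `A`, column of `B`). -/
def controllabilityMatrix {n m : ℕ} (A : Matrix (Fin n) (Fin n) ℝ) (B : Matrix (Fin n) (Fin m) ℝ) :
    Matrix (Fin n) (Fin n × Fin m) ℝ :=
  Matrix.of fun i p => (A ^ (p.1 : ℕ) * B) i p.2

/-- The pair `(A, B)` is controllable (Kalman rank condition). -/
def IsControllable {n m : ℕ} (A : Matrix (Fin n) (Fin n) ℝ) (B : Matrix (Fin n) (Fin m) ℝ) : Prop :=
  (controllabilityMatrix A B).rank = n

/-- The set `𝒢` of stabilizing gains. -/
def stabilizing {n m : ℕ} (A : Matrix (Fin n) (Fin n) ℝ) (B : Matrix (Fin n) (Fin m) ℝ) :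
    Set (Matrix (Fin m) (Fin n) ℝ) :=
  {K | IsHurwitz (A - B * K)}

/-- `P` solves the closed-loop Lyapunov equation of the gain `K`. -/
def SolvesLyapunov {n m : ℕ} (A : Matrix (Fin n) (Fin n) ℝ) (B : Matrix (Fin n) (Fin m) ℝ)
    (Q : Matrix (Fin n) (Fin n) ℝ) (R : Matrix (Fin m) (Fin m) ℝ)
    (K : Matrix (Fin m) (Fin n) ℝ) (P : Matrix (Fin n) (Fin n) ℝ) : Prop :=
  P * (A - B * K) + (A - B * K)ᵀ * P + Kᵀ * R * K + Q = 0

open Classical in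
/-- `P_K`, the solution of the Lyapunov equation (unique when `K` is stabilizing; `0` if there is
no solution, which happens only for gains that are not stabilizing). -/
noncomputable def lyapunovP {n m : ℕ} (A : Matrix (Fin n) (Fin n) ℝ) (B : Matrix (Fin n) (Fin m) ℝ)
    (Q : Matrix (Fin n) (Fin n) ℝ) (R : Matrix (Fin m) (Fin m) ℝ)
    (K : Matrix (Fin m) (Fin n) ℝ) : Matrix (Fin n) (Fin n) ℝ :=
  if h : ∃ P, SolvesLyapunov A B Q R K P then h.choose else 0

/-- The LQR cost `J(K) = tr P_K`. -/
noncomputable def cost {n m : ℕ} (A : Matrix (Fin n) (Fin n) ℝ) (B : Matrix (Fin n) (Fin m) ℝ)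
    (Q : Matrix (Fin n) (Fin n) ℝ) (R : Matrix (Fin m) (Fin m) ℝ)
    (K : Matrix (Fin m) (Fin n) ℝ) : ℝ :=
  (lyapunovP A B Q R K).trace

/-- The gradient of a function of a matrix with respect to the Euclidean (Frobenius) inner product:
the matrix of its partial derivatives. -/
noncomputable def matrixGradient {m n : ℕ} (f : Matrix (Fin m) (Fin n) ℝ → ℝ)
    (K : Matrix (Fin m) (Fin n) ℝ) : Matrix (Fin m) (Fin n) ℝ :=
  Matrix.of fun i j => fderiv ℝ f K (Matrix.single i j 1)

/-- The Euclidean (Frobenius) norm of a matrix. -/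
noncomputable def frobeniusNorm {m n : ℕ} (M : Matrix (Fin m) (Fin n) ℝ) : ℝ :=
  Real.sqrt (∑ i, ∑ j, M i j ^ 2)

end CTLQR

/-! A PL inequality relative to a lower bound `a` of `J` would force quadratic growth, while `J`
grows at most linearly along suitable rays.

Quadratic growth: from a stabilizing `K₁`, minimize `√(J - a) + c‖K - K₁‖` with `c = √μ / 4`. A
minimizer with `J > a` would satisfy `‖∇J‖ ≤ 2c √(J - a)`, contradicting PL; hence `J = a` there,
and `c · dist(K₁, {J = a}) ≤ √(J K₁ - a)` (`exists_near_of_polyakLojasiewicz`). The minimum exists,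
and `{J = a}` is bounded, because sublevel sets are compact (`isCompact_sublevel`): completing the
square bounds `K - R⁻¹BᵀP` by a continuous function of `P`, and `P ⪰ 0` is bounded by its trace.

Linear growth: along `K₀ + ρ R⁻¹BᵀP` with `P = P_{K₀}`, the matrix `ρP` is a supersolution of the
Lyapunov equation for `ρ ≥ 2`, so `J ≤ ρ J(K₀)` (`cost_ray_le`). The direction is nonzero since
controllability with `n > 0` gives `B ≠ 0`. For large `ρ` the two bounds clash. Both non-existence
claims are instances with different `a`. -/

namespace CTLQR

open Matrix Filter Topology

variable {n m : ℕ}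

/-! ### Unique solvability of the Lyapunov equation -/

/-- The only intertwiner of two complex matrices with disjoint spectra is zero. -/
theorem eq_zero_of_mul_eq_mul_of_disjoint_spectrum {M N P : Matrix (Fin n) (Fin n) ℂ}
    (h : N * P = P * M) (hd : Disjoint (spectrum ℂ M) (spectrum ℂ N)) : P = 0 := by
  have hp : ∀ p : Polynomial ℂ, Polynomial.aeval N p * P = P * Polynomial.aeval M p := by
    intro p
    induction p using Polynomial.induction_on with
    | C a => simp [Algebra.commutes]
    | add p q hp hq => simp only [map_add, add_mul, mul_add, hp, hq]
    | monomial k a hk =>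
      simp only [pow_succ, ← mul_assoc, map_mul (Polynomial.aeval N) _ Polynomial.X,
        map_mul (Polynomial.aeval M) _ Polynomial.X, Polynomial.aeval_X]
      rw [mul_assoc, h, ← mul_assoc, hk]
  -- `χ_M(N)` is a product of factors `N - λ` over eigenvalues `λ` of `M`, none of which lies in the
  -- spectrum of `N`; Cayley–Hamilton then gives `χ_M(N) P = P χ_M(M) = 0`.
  have hu : IsUnit (Polynomial.aeval N M.charpoly) := by
    by_contra hnu
    have hsplit := IsAlgClosed.splits M.charpoly
    have hprod := hsplit.eq_prod_roots_of_monic M.charpoly_monic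
    rw [hprod] at hnu
    obtain ⟨k, hk, hk0⟩ := spectrum.exists_mem_of_not_isUnit_aeval_prod hnu
    exact Set.disjoint_left.mp hd (Matrix.mem_spectrum_iff_isRoot_charpoly.mpr hk0) hk
  have := hp M.charpoly
  rw [Matrix.aeval_self_charpoly, mul_zero] at this
  exact (hu.mul_right_eq_zero).mp this

theorem spectrum_transpose_complex (M : Matrix (Fin n) (Fin n) ℂ) :
    spectrum ℂ Mᵀ = spectrum ℂ M := by
  ext z
  rw [Matrix.mem_spectrum_iff_isRoot_charpoly, Matrix.mem_spectrum_iff_isRoot_charpoly,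
    Matrix.charpoly_transpose]

theorem IsHurwitz.transpose {M : Matrix (Fin n) (Fin n) ℝ} (hM : IsHurwitz M) :
    IsHurwitz Mᵀ := by
  intro z hz
  rw [Matrix.transpose_map, spectrum_transpose_complex] at hz
  exact hM z hz

/-- The Lyapunov operator `P ↦ P M + Mᵀ P`, linear in `M`. -/
def lyapunovMap : Matrix (Fin n) (Fin n) ℝ →ₗ[ℝ]
    Matrix (Fin n) (Fin n) ℝ →ₗ[ℝ] Matrix (Fin n) (Fin n) ℝ :=
  LinearMap.mk₂ ℝ (fun M P => P * M + Mᵀ * P)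
    (fun _ _ _ => by simp only [transpose_add, mul_add, add_mul]; abel)
    (fun _ _ _ => by simp)
    (fun _ _ _ => by simp only [mul_add, add_mul]; abel)
    (fun _ _ _ => by simp)

@[simp]
theorem lyapunovMap_apply (M P : Matrix (Fin n) (Fin n) ℝ) :
    lyapunovMap M P = P * M + Mᵀ * P := rfl

/-- A kernel element intertwines `M` and `-Mᵀ`, whose spectra lie in opposite open half planes. -/
theorem IsHurwitz.lyapunovMap_injective {M : Matrix (Fin n) (Fin n) ℝ} (hM : IsHurwitz M) :
    Function.Injective (lyapunovMap M) := by
  rw [injective_iff_map_eq_zero]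
  intro P hP
  rw [lyapunovMap_apply] at hP
  set φ : Matrix (Fin n) (Fin n) ℝ →+* Matrix (Fin n) (Fin n) ℂ := (algebraMap ℝ ℂ).mapMatrix
  have h : (-φ Mᵀ) * φ P = φ P * φ M := by
    rw [← map_neg, ← map_mul, ← map_mul]
    congr 1
    rw [neg_mul, eq_comm]
    exact eq_neg_of_add_eq_zero_left hP
  have h0 : φ P = 0 := by
    refine eq_zero_of_mul_eq_mul_of_disjoint_spectrum h ?_
    rw [Set.disjoint_left]
    intro z hz hz'
    rw [← spectrum.neg_eq, Set.mem_neg] at hz'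
    have h1 := hM z hz
    have h2 := hM.transpose (-z) hz'
    simp at h2
    linarith
  refine Matrix.map_injective (algebraMap ℝ ℂ).injective ?_
  exact h0.trans (map_zero φ).symm

theorem IsHurwitz.lyapunovMap_bijective {M : Matrix (Fin n) (Fin n) ℝ} (hM : IsHurwitz M) :
    Function.Bijective (lyapunovMap M) :=
  ⟨hM.lyapunovMap_injective,
    LinearMap.injective_iff_surjective.mp hM.lyapunovMap_injective⟩

/-- A stabilizing gain has exactly one solution of its Lyapunov equation. -/
theorem existsUnique_solvesLyapunov (A : Matrix (Fin n) (Fin n) ℝ) (B : Matrix (Fin n) (Fin m) ℝ)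
    (Q : Matrix (Fin n) (Fin n) ℝ) (R : Matrix (Fin m) (Fin m) ℝ) {K : Matrix (Fin m) (Fin n) ℝ}
    (hb : Function.Bijective (lyapunovMap (A - B * K))) : ∃! P, SolvesLyapunov A B Q R K P := by
  obtain ⟨P, hP, hu⟩ := hb.existsUnique (-(Kᵀ * R * K + Q))
  have key : ∀ P, SolvesLyapunov A B Q R K P ↔
      lyapunovMap (A - B * K) P = -(Kᵀ * R * K + Q) := by
    intro P
    rw [SolvesLyapunov, lyapunovMap_apply, add_assoc _ _ Q, eq_neg_iff_add_eq_zero]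
  exact ⟨P, (key P).mpr hP, fun P' h' => hu P' ((key P').mp h')⟩

theorem lyapunovP_spec {A : Matrix (Fin n) (Fin n) ℝ} {B : Matrix (Fin n) (Fin m) ℝ}
    {Q : Matrix (Fin n) (Fin n) ℝ} {R : Matrix (Fin m) (Fin m) ℝ} {K : Matrix (Fin m) (Fin n) ℝ}
    (h : ∃ P, SolvesLyapunov A B Q R K P) : SolvesLyapunov A B Q R K (lyapunovP A B Q R K) := by
  rw [lyapunovP, dif_pos h]
  exact h.choose_spec

theorem lyapunovP_eq {A : Matrix (Fin n) (Fin n) ℝ} {B : Matrix (Fin n) (Fin m) ℝ}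
    {Q : Matrix (Fin n) (Fin n) ℝ} {R : Matrix (Fin m) (Fin m) ℝ} {K : Matrix (Fin m) (Fin n) ℝ}
    (hb : Function.Bijective (lyapunovMap (A - B * K))) {P : Matrix (Fin n) (Fin n) ℝ}
    (hP : SolvesLyapunov A B Q R K P) : lyapunovP A B Q R K = P :=
  (existsUnique_solvesLyapunov A B Q R hb).unique (lyapunovP_spec ⟨P, hP⟩) hP

/-! ### Positivity of Lyapunov solutions via the Cayley transform -/

section PowerStable

attribute [local instance] Matrix.linftyOpNormedRing Matrix.linftyOpNormedAlgebra

/-- Powers of a complex matrix with spectrum in the open unit disc tend to zero. -/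
theorem tendsto_pow_zero_of_spectrum_lt_one {T : Matrix (Fin n) (Fin n) ℂ}
    (hT : ∀ z ∈ spectrum ℂ T, ‖z‖ < 1) :
    Filter.Tendsto (fun k : ℕ => T ^ k) Filter.atTop (nhds 0) := by
  rcases isEmpty_or_nonempty (Fin n) with hn | hn
  · have : ∀ k : ℕ, T ^ k = 0 := fun k => Subsingleton.elim _ _
    simp [this]
  have hr : spectralRadius ℂ T < 1 := by
    obtain ⟨z, hz, hzr⟩ := spectrum.exists_nnnorm_eq_spectralRadius T
    rw [← hzr]
    exact_mod_cast hT z hz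
  obtain ⟨r, hr1, hr2⟩ := exists_between hr
  -- By Gelfand's formula, `‖T ^ k‖ ≤ r ^ k` eventually, for some `r < 1`.
  have hG := spectrum.pow_nnnorm_pow_one_div_tendsto_nhds_spectralRadius T
  have hev := (hG.eventually (gt_mem_nhds hr1)).and (Filter.eventually_gt_atTop 0)
  lift r to NNReal using (hr2.trans ENNReal.one_lt_top).ne
  refine tendsto_zero_iff_norm_tendsto_zero.mpr ?_
  have hlim : Filter.Tendsto (fun k : ℕ => (r : ℝ) ^ k) Filter.atTop (nhds 0) :=
    tendsto_pow_atTop_nhds_zero_of_lt_one r.2 (by exact_mod_cast hr2)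
  refine tendsto_of_tendsto_of_tendsto_of_le_of_le' tendsto_const_nhds hlim
    (Filter.Eventually.of_forall fun k => norm_nonneg _) ?_
  filter_upwards [hev] with k hk
  obtain ⟨hk1, hk0⟩ := hk
  have hk' : (k : ℝ) ≠ 0 := by exact_mod_cast hk0.ne'
  have := ENNReal.rpow_le_rpow hk1.le (Nat.cast_nonneg (α := ℝ) k)
  rw [← ENNReal.rpow_mul, one_div_mul_cancel hk', ENNReal.rpow_one, ENNReal.rpow_natCast] at this
  exact_mod_cast this

end PowerStable

/-- The Cayley transform sends the open left half plane into the open unit disc. -/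
theorem norm_lt_one_of_cayley {z w : ℂ} (hw : w.re < 0) (h : z * (1 - w) = 1 + w) : ‖z‖ < 1 := by
  have h1 : ‖z‖ * ‖1 - w‖ = ‖1 + w‖ := by rw [← norm_mul, h]
  have h2 : ‖1 + w‖ < ‖1 - w‖ := by
    rw [← sq_lt_sq₀ (norm_nonneg _) (norm_nonneg _), ← Complex.normSq_eq_norm_sq,
      ← Complex.normSq_eq_norm_sq, Complex.normSq_apply, Complex.normSq_apply]
    simp
    nlinarith
  by_contra hz
  push Not at hz
  nlinarith [norm_nonneg (1 - w)]

/-- The Cayley transform of a Hurwitz matrix. -/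
noncomputable def cayley (M : Matrix (Fin n) (Fin n) ℝ) : Matrix (Fin n) (Fin n) ℝ :=
  (1 + M) * (1 - M)⁻¹

theorem IsHurwitz.isUnit_one_sub {M : Matrix (Fin n) (Fin n) ℝ} (hM : IsHurwitz M) :
    IsUnit (1 - M) := by
  by_contra h
  have hz : (1 : ℂ) ∈ spectrum ℂ (M.map (algebraMap ℝ ℂ)) := by
    rw [spectrum.mem_iff]
    intro hu
    apply h
    rw [Matrix.isUnit_iff_isUnit_det] at hu ⊢
    have e : (algebraMap ℂ (Matrix (Fin n) (Fin n) ℂ)) 1 - M.map (algebraMap ℝ ℂ) =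
        (algebraMap ℝ ℂ).mapMatrix (1 - M) := by
      rw [map_sub, map_one, map_one, RingHom.mapMatrix_apply]
    rw [e, ← RingHom.map_det] at hu
    simpa [isUnit_iff_ne_zero] using hu
  have := hM 1 hz
  norm_num at this

/-- An eigenvalue `z ≠ -1` of the Cayley transform comes from the eigenvalue `(z - 1) / (z + 1)` of
`M`; for `z = -1` the pencil is the invertible scalar `-2`. -/
theorem IsHurwitz.spectrum_cayley {M : Matrix (Fin n) (Fin n) ℝ} (hM : IsHurwitz M) :
    ∀ z ∈ spectrum ℂ ((algebraMap ℝ ℂ).mapMatrix (cayley M)), ‖z‖ < 1 := by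
  intro z hz
  set φ : Matrix (Fin n) (Fin n) ℝ →+* Matrix (Fin n) (Fin n) ℂ := (algebraMap ℝ ℂ).mapMatrix
  have hcay : φ (cayley M) * (1 - φ M) = 1 + φ M := by
    rw [← map_one φ, ← map_sub, ← map_mul, ← map_add, cayley,
      Matrix.nonsing_inv_mul_cancel_right _ _
        ((Matrix.isUnit_iff_isUnit_det _).mp hM.isUnit_one_sub)]
  have hu1 : IsUnit (1 - φ M) := by
    rw [← map_one φ, ← map_sub]; exact hM.isUnit_one_sub.map φ
  rw [spectrum.mem_iff] at hz
  have hnu : ¬ IsUnit ((algebraMap ℂ (Matrix (Fin n) (Fin n) ℂ) z - φ (cayley M)) * (1 - φ M)) := by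
    intro h
    apply hz
    have := h.mul hu1.unit⁻¹.isUnit
    rwa [mul_assoc, hu1.mul_val_inv, mul_one] at this
  have hexp : (algebraMap ℂ (Matrix (Fin n) (Fin n) ℂ) z - φ (cayley M)) * (1 - φ M) =
      algebraMap ℂ _ (z - 1) - (z + 1) • φ M := by
    rw [sub_mul, hcay, Algebra.algebraMap_eq_smul_one, Algebra.algebraMap_eq_smul_one]
    simp only [smul_mul_assoc, one_mul, smul_sub, sub_smul, add_smul, one_smul]
    abel
  rw [hexp] at hnu
  by_cases hz1 : z + 1 = 0
  · exfalso
    apply hnu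
    have : z = -1 := eq_neg_of_add_eq_zero_left hz1
    subst this
    simp only [hz1, zero_smul, sub_zero]
    exact (IsUnit.mk0 _ (by norm_num)).map _
  · have hw : (z - 1) / (z + 1) ∈ spectrum ℂ (M.map (algebraMap ℝ ℂ)) := by
      rw [spectrum.mem_iff]
      intro h
      apply hnu
      have h2 := ((IsUnit.mk0 _ hz1).map (algebraMap ℂ (Matrix (Fin n) (Fin n) ℂ))).mul h
      rw [mul_sub, ← map_mul, mul_div_cancel₀ _ hz1, ← Algebra.smul_def] at h2
      exact h2
    refine norm_lt_one_of_cayley (hM _ hw) ?_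
    field_simp
    ring

theorem IsHurwitz.tendsto_cayley_pow {M : Matrix (Fin n) (Fin n) ℝ} (hM : IsHurwitz M) :
    Filter.Tendsto (fun k : ℕ => cayley M ^ k) Filter.atTop (nhds 0) := by
  have h := tendsto_pow_zero_of_spectrum_lt_one hM.spectrum_cayley
  have h2 : Filter.Tendsto (fun k : ℕ => ((cayley M ^ k).map (algebraMap ℝ ℂ)).map Complex.re)
      Filter.atTop (nhds ((0 : Matrix (Fin n) (Fin n) ℂ).map Complex.re)) := by
    have hc : Continuous fun X : Matrix (Fin n) (Fin n) ℂ => X.map Complex.re :=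
      continuous_id.matrix_map Complex.continuous_re
    refine (hc.tendsto 0).comp (h.congr fun k => ?_)
    rw [← map_pow]; rfl
  convert h2 using 2
  · ext; simp
  · ext; simp

theorem _root_.Matrix.PosSemidef.transpose_eq {k : ℕ} {W : Matrix (Fin k) (Fin k) ℝ}
    (hW : W.PosSemidef) : Wᵀ = W := by
  rw [← conjTranspose_eq_transpose_of_trivial]
  exact hW.isHermitian

/-- A Hurwitz Lyapunov equation with positive semidefinite right-hand side has a positive
semidefinite solution. -/
theorem IsHurwitz.posSemidef_of_lyapunov {M P W : Matrix (Fin n) (Fin n) ℝ} (hM : IsHurwitz M)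
    (hW : W.PosSemidef) (h : P * M + Mᵀ * P + W = 0) : P.PosSemidef := by
  have hWt : Wᵀ = W := hW.transpose_eq
  -- `Pᵀ` solves the same equation, so injectivity gives symmetry.
  have hPt : Pᵀ = P := by
    apply hM.lyapunovMap_injective
    simp only [lyapunovMap_apply]
    have h' := congrArg Matrix.transpose h
    simp only [transpose_add, transpose_mul, transpose_transpose, transpose_zero, hWt] at h'
    rw [add_comm (Mᵀ * Pᵀ)] at h'
    exact (eq_neg_of_add_eq_zero_left h').trans (eq_neg_of_add_eq_zero_left h).symm
  set T := cayley M
  set S := (1 - M)⁻¹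
  have hdet := (Matrix.isUnit_iff_isUnit_det _).mp hM.isUnit_one_sub
  have hS : (1 - M) * S = 1 := Matrix.mul_nonsing_inv _ hdet
  have hSt : Sᵀ * (1 - Mᵀ) = 1 := by
    have := congrArg Matrix.transpose hS
    simpa using this
  -- Congruence by `(1 - M)⁻¹` turns the Lyapunov equation into a Stein equation: the form of `P`
  -- does not increase under `T`, and `T ^ k → 0` makes it nonnegative.
  have hstein : P = Tᵀ * P * T + Sᵀ * ((2 : ℝ) • W) * S := by
    have h1 : (1 - Mᵀ) * P * (1 - M) = (1 + Mᵀ) * P * (1 + M) + (2 : ℝ) • W := by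
      have : W = -(P * M + Mᵀ * P) := (neg_eq_of_add_eq_zero_right h).symm
      rw [this, two_smul]
      noncomm_ring
    have hT : T = (1 + M) * S := rfl
    have hTt : Tᵀ = Sᵀ * (1 + Mᵀ) := by rw [hT]; simp
    calc P = (Sᵀ * (1 - Mᵀ)) * P * ((1 - M) * S) := by rw [hS, hSt]; simp
      _ = Sᵀ * ((1 - Mᵀ) * P * (1 - M)) * S := by noncomm_ring
      _ = _ := by rw [h1, hTt, hT]; noncomm_ring
  have hstep : ∀ x : Fin n → ℝ, (T *ᵥ x) ⬝ᵥ (P *ᵥ (T *ᵥ x)) ≤ x ⬝ᵥ (P *ᵥ x) := by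
    intro x
    have hpos := (hW.smul (zero_le_two (α := ℝ))).dotProduct_mulVec_nonneg (S *ᵥ x)
    have : x ⬝ᵥ (P *ᵥ x) = (T *ᵥ x) ⬝ᵥ (P *ᵥ (T *ᵥ x)) +
        (S *ᵥ x) ⬝ᵥ (((2 : ℝ) • W) *ᵥ (S *ᵥ x)) := by
      conv_lhs => rw [hstein]
      rw [add_mulVec, dotProduct_add]
      simp only [← mulVec_mulVec, dotProduct_mulVec _ Tᵀ, dotProduct_mulVec _ Sᵀ, vecMul_transpose]
    rw [star_trivial] at hpos
    linarith
  have hpow : ∀ (x : Fin n → ℝ) (k : ℕ),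
      (T ^ k *ᵥ x) ⬝ᵥ (P *ᵥ (T ^ k *ᵥ x)) ≤ x ⬝ᵥ (P *ᵥ x) := by
    intro x k
    induction k with
    | zero => simp
    | succ k ih =>
      rw [pow_succ', ← mulVec_mulVec]
      exact (hstep _).trans ih
  refine Matrix.PosSemidef.of_dotProduct_mulVec_nonneg (by
    rw [Matrix.IsHermitian, conjTranspose_eq_transpose_of_trivial, hPt]) fun x => ?_
  rw [star_trivial]
  have hc : Continuous fun X : Matrix (Fin n) (Fin n) ℝ => (X *ᵥ x) ⬝ᵥ (P *ᵥ (X *ᵥ x)) := by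
    fun_prop
  have hlim := (hc.tendsto 0).comp hM.tendsto_cayley_pow
  simp only [zero_mulVec, zero_dotProduct] at hlim
  exact le_of_tendsto' hlim fun k => hpow x k

/-! ### Lyapunov certificates of stability -/

/-- Lyapunov's criterion: a positive semidefinite matrix whose quadratic form strictly decreases
along `M` certifies that `M` is Hurwitz. -/
theorem isHurwitz_of_lyapunov {M P : Matrix (Fin n) (Fin n) ℝ} (hP : P.PosSemidef)
    (h : ∀ x : Fin n → ℝ, x ≠ 0 → x ⬝ᵥ (P *ᵥ (M *ᵥ x)) < 0) : IsHurwitz M := by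
  intro z hz
  rw [spectrum.mem_iff, Matrix.isUnit_iff_isUnit_det, isUnit_iff_ne_zero, not_not,
    ← Matrix.exists_mulVec_eq_zero_iff] at hz
  obtain ⟨v, hv, hMv⟩ := hz
  rw [sub_mulVec, sub_eq_zero, Algebra.algebraMap_eq_smul_one, smul_mulVec, one_mulVec] at hMv
  set x : Fin n → ℝ := fun i => (v i).re
  set y : Fin n → ℝ := fun i => (v i).im
  have hx : M *ᵥ x = z.re • x - z.im • y := by
    ext i
    have := congrArg Complex.re (congrFun hMv i)
    simp [mulVec, dotProduct] at this
    simp [mulVec, dotProduct, x, y, this]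
  have hy : M *ᵥ y = z.im • x + z.re • y := by
    ext i
    have := congrArg Complex.im (congrFun hMv i)
    simp [mulVec, dotProduct] at this
    simp [mulVec, dotProduct, x, y, ← this]
    ring
  have hPt : Pᵀ = P := hP.transpose_eq
  have hsymm : y ⬝ᵥ (P *ᵥ x) = x ⬝ᵥ (P *ᵥ y) := by
    rw [dotProduct_mulVec, ← mulVec_transpose, hPt, dotProduct_comm]
  have hle : ∀ x : Fin n → ℝ, x ⬝ᵥ (P *ᵥ (M *ᵥ x)) ≤ 0 := by
    intro x
    by_cases hx : x = 0
    · simp [hx]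
    · exact (h x hx).le
  -- For an eigenvector `x + iy` the cross terms cancel by symmetry of `P`, and this sum equals `Re
  -- z · (xᵀPx + yᵀPy)`.
  have hsum : x ⬝ᵥ (P *ᵥ (M *ᵥ x)) + y ⬝ᵥ (P *ᵥ (M *ᵥ y)) < 0 := by
    by_cases hx0 : x = 0
    · have hy0 : y ≠ 0 := by
        intro hy0
        apply hv
        ext i
        exact Complex.ext (congrFun hx0 i) (congrFun hy0 i)
      linarith [hle x, h y hy0]
    · linarith [hle y, h x hx0]
  have hxx := hP.dotProduct_mulVec_nonneg x
  have hyy := hP.dotProduct_mulVec_nonneg y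
  rw [star_trivial] at hxx hyy
  rw [hx, hy] at hsum
  simp only [mulVec_sub, mulVec_add, mulVec_smul, dotProduct_sub, dotProduct_add, dotProduct_smul,
    smul_eq_mul, hsymm] at hsum
  by_contra hre
  push Not at hre
  nlinarith [mul_nonneg hre hxx, mul_nonneg hre hyy]

theorem two_mul_dotProduct_of_lyapunov {M P W : Matrix (Fin n) (Fin n) ℝ} (hP : P.PosSemidef)
    (h : P * M + Mᵀ * P + W = 0) (x : Fin n → ℝ) :
    2 * (x ⬝ᵥ (P *ᵥ (M *ᵥ x))) = -(x ⬝ᵥ (W *ᵥ x)) := by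
  have hPt : Pᵀ = P := hP.transpose_eq
  have h1 := congrArg (fun X => x ⬝ᵥ (X *ᵥ x)) h
  simp only [add_mulVec, dotProduct_add, zero_mulVec, dotProduct_zero, ← mulVec_mulVec] at h1
  have h2 : x ⬝ᵥ (Mᵀ *ᵥ (P *ᵥ x)) = x ⬝ᵥ (P *ᵥ (M *ᵥ x)) := by
    rw [dotProduct_mulVec, vecMul_transpose, dotProduct_mulVec _ P, ← mulVec_transpose, hPt,
      dotProduct_comm]
  linarith

theorem isHurwitz_of_lyapunov_posDef {M P W : Matrix (Fin n) (Fin n) ℝ} (hP : P.PosSemidef)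
    (hW : W.PosDef) (h : P * M + Mᵀ * P + W = 0) : IsHurwitz M := by
  refine isHurwitz_of_lyapunov hP fun x hx => ?_
  have h1 := two_mul_dotProduct_of_lyapunov hP h x
  have h2 := hW.dotProduct_mulVec_pos hx
  rw [star_trivial] at h2
  linarith

/-- The positive semidefinite solution of a Lyapunov equation with positive definite right-hand
side is positive definite. -/
theorem posDef_of_lyapunov {M P W : Matrix (Fin n) (Fin n) ℝ} (hP : P.PosSemidef)
    (hW : W.PosDef) (h : P * M + Mᵀ * P + W = 0) : P.PosDef := by
  rw [hP.posDef_iff_isUnit, Matrix.isUnit_iff_isUnit_det, isUnit_iff_ne_zero, ne_eq,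
    ← Matrix.exists_mulVec_eq_zero_iff]
  rintro ⟨x, hx, hPx⟩
  have hPt : Pᵀ = P := hP.transpose_eq
  have h1 := two_mul_dotProduct_of_lyapunov hP h x
  have h2 := hW.dotProduct_mulVec_pos hx
  rw [star_trivial] at h2
  rw [dotProduct_mulVec _ P, ← mulVec_transpose, hPt, hPx, zero_dotProduct] at h1
  linarith

/-! ### Controllable pairs are stabilizable -/

theorem IsControllable.eq_zero {A : Matrix (Fin n) (Fin n) ℝ} {B : Matrix (Fin n) (Fin m) ℝ}
    (h : IsControllable A B) {x : Fin n → ℝ} (hx : ∀ k : ℕ, x ᵥ* (A ^ k * B) = 0) : x = 0 := by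
  have hli : LinearIndependent ℝ (controllabilityMatrix A B).row := by
    rw [linearIndependent_iff_card_eq_finrank_span, Set.finrank,
      ← Matrix.rank_eq_finrank_span_row]
    simpa using h.symm
  have hinj := Matrix.vecMul_injective_iff.mpr hli
  apply hinj
  ext p
  have := congrFun (hx p.1) p.2
  simpa [vecMul, dotProduct, controllabilityMatrix] using this

/-- For `β` large, `-(A + β)ᵀ` is Hurwitz. -/
theorem exists_isHurwitz_neg_shift (A : Matrix (Fin n) (Fin n) ℝ) :
    ∃ β : ℝ, 0 < β ∧ IsHurwitz (-(A + β • (1 : Matrix (Fin n) (Fin n) ℝ))ᵀ) := by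
  have hfin : (spectrum ℂ (A.map (algebraMap ℝ ℂ))).Finite := Matrix.finite_spectrum _
  obtain ⟨b, hb⟩ := (hfin.image Complex.re).bddBelow
  refine ⟨max 1 (1 - b), by positivity, ?_⟩
  set β := max 1 (1 - b) with hβ
  suffices IsHurwitz (-(A + β • (1 : Matrix (Fin n) (Fin n) ℝ))) by
    rw [← transpose_neg]
    exact this.transpose
  intro z hz
  have e : (-(A + β • (1 : Matrix (Fin n) (Fin n) ℝ))).map (algebraMap ℝ ℂ) =
      -(algebraMap ℂ (Matrix (Fin n) (Fin n) ℂ) β + A.map (algebraMap ℝ ℂ)) := by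
    ext i j
    simp [Matrix.algebraMap_matrix_apply, Matrix.one_apply, add_comm]
    split_ifs <;> simp
  rw [e, ← spectrum.neg_eq, Set.mem_neg, ← spectrum.singleton_add_eq, Set.singleton_add] at hz
  obtain ⟨w, hw, hwz⟩ := hz
  have h1 := hb ⟨w, hw, rfl⟩
  have h2 := congrArg Complex.re hwz
  simp at h2
  have : 1 - b ≤ β := le_max_right _ _
  linarith

/-- A controllable pair is stabilizable. -/
theorem IsControllable.stabilizing_nonempty {A : Matrix (Fin n) (Fin n) ℝ}
    {B : Matrix (Fin n) (Fin m) ℝ} (h : IsControllable A B) : (stabilizing A B).Nonempty := by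
  obtain ⟨β, hβ, hH⟩ := exists_isHurwitz_neg_shift A
  set F := A + β • (1 : Matrix (Fin n) (Fin n) ℝ) with hF
  -- Bass's construction: `F Z + Z Fᵀ = 2 B Bᵀ`, and the gain will be `Bᵀ Z⁻¹`.
  obtain ⟨Z, hZ⟩ := hH.lyapunovMap_bijective.2 (-((2 : ℝ) • (B * Bᵀ)))
  rw [lyapunovMap_apply, ← add_eq_zero_iff_eq_neg] at hZ
  have hBB : (B * Bᵀ).PosSemidef := by
    simpa [conjTranspose_eq_transpose_of_trivial] using posSemidef_self_mul_conjTranspose B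
  have hZp : Z.PosSemidef := hH.posSemidef_of_lyapunov (hBB.smul (zero_le_two (α := ℝ))) hZ
  have hZt : Zᵀ = Z := hZp.transpose_eq
  -- The kernel of `Z` lies in that of `Bᵀ` and is `Aᵀ`-invariant, so controllability makes it
  -- trivial.
  have hker : ∀ x : Fin n → ℝ, Z *ᵥ x = 0 → Bᵀ *ᵥ x = 0 ∧ Z *ᵥ (Aᵀ *ᵥ x) = 0 := by
    intro x hx
    have h1 := two_mul_dotProduct_of_lyapunov hZp hZ x
    rw [dotProduct_mulVec _ Z, ← mulVec_transpose, hZt, hx, zero_dotProduct, smul_mulVec,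
      dotProduct_smul, ← mulVec_mulVec, dotProduct_mulVec _ B, ← mulVec_transpose] at h1
    have hB : Bᵀ *ᵥ x = 0 := by
      apply dotProduct_self_eq_zero.mp
      simp only [smul_eq_mul] at h1
      linarith
    refine ⟨hB, ?_⟩
    have h2 := congrArg (· *ᵥ x) hZ
    simp only [add_mulVec, ← mulVec_mulVec, hx, hB, smul_mulVec, mulVec_zero, smul_zero, add_zero,
      zero_mulVec, hF, transpose_add, transpose_smul, transpose_one, neg_mulVec, one_mulVec,
      mulVec_neg, mulVec_add, mulVec_smul, neg_eq_zero] at h2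
    exact h2
  have hpow : ∀ (k : ℕ) (x : Fin n → ℝ), Z *ᵥ x = 0 → x ᵥ* (A ^ k * B) = 0 := by
    intro k
    induction k with
    | zero =>
      intro x hx
      rw [pow_zero, Matrix.one_mul, ← mulVec_transpose]
      exact (hker x hx).1
    | succ k ih =>
      intro x hx
      rw [pow_succ', Matrix.mul_assoc, ← vecMul_vecMul, ← mulVec_transpose A]
      exact ih _ (hker x hx).2
  have hZd : Z.PosDef := by
    rw [hZp.posDef_iff_isUnit, Matrix.isUnit_iff_isUnit_det, isUnit_iff_ne_zero, ne_eq,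
      ← Matrix.exists_mulVec_eq_zero_iff]
    rintro ⟨x, hx, hZx⟩
    exact hx (h.eq_zero fun k => hpow k x hZx)
  have hdet : IsUnit Z.det := (Matrix.isUnit_iff_isUnit_det _).mp hZd.isUnit
  -- The certificate is `Z⁻¹`, with right-hand side `2β Z⁻¹`.
  refine ⟨Bᵀ * Z⁻¹, isHurwitz_of_lyapunov_posDef hZd.inv.posSemidef
    (hZd.inv.smul (mul_pos two_pos hβ)) ?_⟩
  have hZi : Z * Z⁻¹ = 1 := Matrix.mul_nonsing_inv _ hdet
  have hiZ : Z⁻¹ * Z = 1 := Matrix.nonsing_inv_mul _ hdet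
  have hit : (Z⁻¹)ᵀ = Z⁻¹ := by rw [Matrix.transpose_nonsing_inv, hZt]
  have hA : Z * Aᵀ + A * Z = (2 : ℝ) • (B * Bᵀ) - (2 * β) • Z := by
    have h3 : Z * -Fᵀ + (-Fᵀ)ᵀ * Z + (2 : ℝ) • (B * Bᵀ) =
        -(Z * Aᵀ + A * Z) + ((2 : ℝ) • (B * Bᵀ) - (2 * β) • Z) := by
      simp only [hF, transpose_neg, transpose_transpose, transpose_add, transpose_smul,
        transpose_one, neg_add, mul_add, add_mul, Matrix.mul_neg, Matrix.neg_mul, Matrix.mul_smul,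
        Matrix.smul_mul, Matrix.mul_one, Matrix.one_mul, mul_smul, two_smul]
      abel
    rw [h3, neg_add_eq_zero] at hZ
    exact hZ
  have h4 : Z⁻¹ * A + Aᵀ * Z⁻¹ = Z⁻¹ * (Z * Aᵀ + A * Z) * Z⁻¹ := by
    calc Z⁻¹ * A + Aᵀ * Z⁻¹ = Z⁻¹ * A * (Z * Z⁻¹) + (Z⁻¹ * Z) * Aᵀ * Z⁻¹ := by
          rw [hZi, hiZ]; simp
      _ = _ := by noncomm_ring
  have h5 : Z⁻¹ * (A - B * (Bᵀ * Z⁻¹)) + (A - B * (Bᵀ * Z⁻¹))ᵀ * Z⁻¹ =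
      (Z⁻¹ * A + Aᵀ * Z⁻¹) - (2 : ℝ) • (Z⁻¹ * (B * Bᵀ) * Z⁻¹) := by
    simp only [transpose_sub, transpose_mul, transpose_transpose, hit, mul_sub, sub_mul,
      Matrix.mul_assoc, two_smul]
    abel
  have h6 : Z⁻¹ * ((2 : ℝ) • (B * Bᵀ) - (2 * β) • Z) * Z⁻¹ =
      (2 : ℝ) • (Z⁻¹ * (B * Bᵀ) * Z⁻¹) - (2 * β) • Z⁻¹ := by
    rw [mul_sub, sub_mul, Matrix.mul_smul, Matrix.smul_mul, Matrix.mul_smul, Matrix.smul_mul,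
      hiZ, Matrix.one_mul]
  rw [h5, h4, hA, h6]
  abel

/-! ### Positivity of `P_K` and openness of the stabilizing set -/

theorem lyapunovP_posDef {A : Matrix (Fin n) (Fin n) ℝ} {B : Matrix (Fin n) (Fin m) ℝ}
    {Q : Matrix (Fin n) (Fin n) ℝ} {R : Matrix (Fin m) (Fin m) ℝ} (hQ : Q.PosDef) (hR : R.PosDef)
    {K : Matrix (Fin m) (Fin n) ℝ} (hK : K ∈ stabilizing A B) :
    (lyapunovP A B Q R K).PosDef := by
  have hH : IsHurwitz (A - B * K) := hK
  have hs := lyapunovP_spec (existsUnique_solvesLyapunov A B Q R hH.lyapunovMap_bijective).exists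
  rw [SolvesLyapunov, add_assoc _ _ Q] at hs
  have hKRK : (Kᵀ * R * K).PosSemidef := by
    simpa [conjTranspose_eq_transpose_of_trivial] using
      hR.posSemidef.conjTranspose_mul_mul_same K
  have hW : (Kᵀ * R * K + Q).PosDef := hQ.posSemidef_add hKRK
  exact posDef_of_lyapunov (hH.posSemidef_of_lyapunov hW.posSemidef hs) hW hs

/-- A gain is stabilizing with `P_K = P` as soon as `P` is a positive semidefinite solution of its
Lyapunov equation. -/
theorem mem_stabilizing_of_solvesLyapunov {A : Matrix (Fin n) (Fin n) ℝ}
    {B : Matrix (Fin n) (Fin m) ℝ} {Q : Matrix (Fin n) (Fin n) ℝ} {R : Matrix (Fin m) (Fin m) ℝ}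
    (hQ : Q.PosDef) (hR : R.PosDef) {K : Matrix (Fin m) (Fin n) ℝ} {P : Matrix (Fin n) (Fin n) ℝ}
    (hP : P.PosSemidef) (h : SolvesLyapunov A B Q R K P) : K ∈ stabilizing A B := by
  rw [SolvesLyapunov, add_assoc _ _ Q] at h
  have hKRK : (Kᵀ * R * K).PosSemidef := by
    simpa [conjTranspose_eq_transpose_of_trivial] using
      hR.posSemidef.conjTranspose_mul_mul_same K
  exact isHurwitz_of_lyapunov_posDef hP (hQ.posSemidef_add hKRK) h

/-- A Lyapunov certificate for `K` still works for nearby gains: its strict decrease persists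
uniformly on the compact unit sphere, then extends by homogeneity. -/
theorem eventually_mem_stabilizing {A : Matrix (Fin n) (Fin n) ℝ} {B : Matrix (Fin n) (Fin m) ℝ}
    {K : Matrix (Fin m) (Fin n) ℝ} (hK : K ∈ stabilizing A B) :
    ∀ᶠ K' in 𝓝 K, K' ∈ stabilizing A B := by
  have hH : IsHurwitz (A - B * K) := hK
  obtain ⟨P, hP⟩ := hH.lyapunovMap_bijective.2 (-1)
  rw [lyapunovMap_apply, ← add_eq_zero_iff_eq_neg] at hP
  have hPp := hH.posSemidef_of_lyapunov PosDef.one.posSemidef hP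
  have hcpt : IsCompact (Metric.sphere (0 : Fin n → ℝ) 1) := isCompact_sphere _ _
  have hc : Continuous fun p : Matrix (Fin m) (Fin n) ℝ × (Fin n → ℝ) =>
      p.2 ⬝ᵥ (P *ᵥ ((A - B * p.1) *ᵥ p.2)) := by fun_prop
  have hev : ∀ᶠ K' in 𝓝 K, ∀ x ∈ Metric.sphere (0 : Fin n → ℝ) 1,
      x ⬝ᵥ (P *ᵥ ((A - B * K') *ᵥ x)) < 0 := by
    refine hcpt.eventually_forall_of_forall_eventually fun x hx => ?_
    refine (hc.tendsto (K, x)).eventually (gt_mem_nhds ?_)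
    have hx0 : x ≠ 0 := by
      rintro rfl
      simp at hx
    have h1 := two_mul_dotProduct_of_lyapunov hPp hP x
    have h2 := (PosDef.one (n := Fin n) (R := ℝ)).dotProduct_mulVec_pos hx0
    rw [star_trivial] at h2
    simp only
    linarith
  filter_upwards [hev] with K' hK'
  refine isHurwitz_of_lyapunov hPp fun x hx => ?_
  have hx' : 0 < ‖x‖ := norm_pos_iff.mpr hx
  have h1 := hK' (‖x‖⁻¹ • x) (by simp [norm_smul, hx'.ne'])
  simp only [mulVec_smul, dotProduct_smul, smul_dotProduct, smul_eq_mul] at h1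
  by_contra hcon
  push Not at hcon
  have : 0 ≤ ‖x‖⁻¹ * (‖x‖⁻¹ * (x ⬝ᵥ (P *ᵥ ((A - B * K') *ᵥ x)))) := by positivity
  linarith

/-! ### Differentiability of the cost -/

/-- Solutions of a differentiable family of bijective linear equations are differentiable. -/
theorem differentiableAt_solution {E V : Type*} [NormedAddCommGroup E] [NormedSpace ℝ E]
    [NormedAddCommGroup V] [NormedSpace ℝ V] [FiniteDimensional ℝ V]
    {L : E → V →ₗ[ℝ] V} {w g : E → V} {x : E} (hL : ∀ v, DifferentiableAt ℝ (fun y => L y v) x)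
    (hw : DifferentiableAt ℝ w x) (hx : Function.Bijective (L x))
    (hg : ∀ y, Function.Bijective (L y) → L y (g y) = w y) : DifferentiableAt ℝ g x := by
  have : CompleteSpace V := FiniteDimensional.complete ℝ V
  let C : E → V →L[ℝ] V := fun y => LinearMap.toContinuousLinearMap (L y)
  have hC : DifferentiableAt ℝ C x := by
    -- Expanding in a basis writes the operator as a finite sum of rank-one terms, so pointwise
    -- differentiability upgrades to operator norm.
    let b := Module.finBasis ℝ V
    have hsum : C = fun y => ∑ i, ContinuousLinearMap.smulRightL ℝ V V
        (LinearMap.toContinuousLinearMap (b.coord i)) (L y (b i)) := by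
      ext y v
      simp only [C, LinearMap.coe_toContinuousLinearMap', _root_.sum_apply,
        ContinuousLinearMap.smulRightL_apply_apply]
      conv_lhs => rw [← b.sum_repr v, map_sum]
      simp only [map_smul]
      rfl
    rw [hsum]
    refine DifferentiableAt.fun_sum fun i _ => ?_
    exact ((ContinuousLinearMap.smulRightL ℝ V V
      (LinearMap.toContinuousLinearMap (b.coord i))).differentiableAt).comp x (hL (b i))
  let e : V ≃L[ℝ] V := (LinearEquiv.ofBijective (L x) hx).toContinuousLinearEquiv
  have he : (e : V →L[ℝ] V) = C x := by
    ext; rfl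
  have hinv : DifferentiableAt ℝ (ContinuousLinearMap.inverse : (V →L[ℝ] V) → V →L[ℝ] V)
      (C x) := by
    rw [← he]
    exact (contDiffAt_map_inverse (n := 1) e).differentiableAt one_ne_zero
  have hP : DifferentiableAt ℝ (fun y => (C y).inverse (w y)) x :=
    (hinv.comp x hC).clm_apply hw
  refine hP.congr_of_eventuallyEq ?_
  -- Invertibility is an open condition, so near `x` the solution is the inverse operator applied to
  -- `w y`.
  have hnhds : ∀ᶠ y in 𝓝 x, C y ∈ Set.range ((↑) : (V ≃L[ℝ] V) → (V →L[ℝ] V)) := by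
    refine hC.continuousAt.eventually_mem ?_
    rw [← he]
    exact ContinuousLinearEquiv.nhds e
  filter_upwards [hnhds] with y ⟨e', he'⟩
  have h2 : ∀ v, L y v = e' v := fun v => (congrArg (fun f : V →L[ℝ] V => f v) he').symm
  have hb : Function.Bijective (L y) := by
    have : (L y : V → V) = e' := funext h2
    rw [this]
    exact e'.bijective
  rw [← he', ContinuousLinearMap.inverse_equiv, ← hg y hb, h2]
  exact (e'.symm_apply_apply _).symm

theorem differentiableAt_cost_of_bijective (A : Matrix (Fin n) (Fin n) ℝ)
    (B : Matrix (Fin n) (Fin m) ℝ) (Q : Matrix (Fin n) (Fin n) ℝ) (R : Matrix (Fin m) (Fin m) ℝ)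
    {K : Matrix (Fin m) (Fin n) ℝ} (hK : Function.Bijective (lyapunovMap (A - B * K))) :
    DifferentiableAt ℝ (cost A B Q R) K := by
  have hP : DifferentiableAt ℝ (fun K' : Fin m → Fin n → ℝ =>
      (lyapunovP A B Q R (of K') : Fin n → Fin n → ℝ)) K := by
    refine differentiableAt_solution (E := Fin m → Fin n → ℝ) (V := Fin n → Fin n → ℝ)
      (L := fun K' => lyapunovMap (A - B * of K')) (w := fun K' => -((of K')ᵀ * R * of K' + Q))
      (g := fun K' => lyapunovP A B Q R (of K'))
      ?_ ?_ hK ?_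
    · intro P
      refine differentiableAt_pi.mpr fun i => differentiableAt_pi.mpr fun j => ?_
      change DifferentiableAt ℝ (fun K' : Fin m → Fin n → ℝ =>
        (of P * (A - B * of K') + (A - B * of K')ᵀ * of P) i j) K
      simp only [Matrix.add_apply, Matrix.mul_apply, Matrix.sub_apply, transpose_apply,
        Matrix.of_apply]
      fun_prop
    · refine differentiableAt_pi.mpr fun i => differentiableAt_pi.mpr fun j => ?_
      change DifferentiableAt ℝ (fun K' : Fin m → Fin n → ℝ =>
        -(((of K')ᵀ * R * of K') i j + Q i j)) K
      simp only [Matrix.mul_apply, transpose_apply, Matrix.of_apply]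
      fun_prop
    · intro K' hb
      have h := lyapunovP_spec (existsUnique_solvesLyapunov A B Q R hb).exists
      rw [SolvesLyapunov, add_assoc _ _ Q, ← eq_neg_iff_add_eq_zero, ← lyapunovMap_apply] at h
      exact h
  have hJ : DifferentiableAt ℝ (fun K' : Fin m → Fin n → ℝ =>
      ∑ i, (lyapunovP A B Q R (of K') : Fin n → Fin n → ℝ) i i) K := by
    refine DifferentiableAt.fun_sum fun i _ => ?_
    exact differentiableAt_pi.mp (differentiableAt_pi.mp hP i) i
  exact hJ

theorem differentiableAt_cost (A : Matrix (Fin n) (Fin n) ℝ)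
    (B : Matrix (Fin n) (Fin m) ℝ) (Q : Matrix (Fin n) (Fin n) ℝ) (R : Matrix (Fin m) (Fin m) ℝ)
    {K : Matrix (Fin m) (Fin n) ℝ} (hK : K ∈ stabilizing A B) :
    DifferentiableAt ℝ (cost A B Q R) K :=
  differentiableAt_cost_of_bijective A B Q R (IsHurwitz.lyapunovMap_bijective hK)

/-! ### Compactness of sublevel sets -/

theorem abs_apply_le_trace {P : Matrix (Fin n) (Fin n) ℝ} (hP : P.PosSemidef) (i j : Fin n) :
    |P i j| ≤ P.trace := by
  have hdiag : ∀ i, P i i ≤ P.trace := fun i =>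
    Finset.single_le_sum (f := fun i => P i i) (fun k _ => hP.diag_nonneg) (Finset.mem_univ i)
  have hsym : P j i = P i j := congrFun (congrFun hP.transpose_eq i) j
  have h1 := hP.dotProduct_mulVec_nonneg (Pi.single i 1 + Pi.single j 1)
  have h2 := hP.dotProduct_mulVec_nonneg (Pi.single i 1 - Pi.single j 1)
  simp only [star_trivial, mulVec_add, mulVec_sub, dotProduct_add, dotProduct_sub, add_dotProduct,
    sub_dotProduct, mulVec_single_one, single_one_dotProduct, col_apply, hsym] at h1 h2
  have := hdiag i
  have := hdiag j
  rw [abs_le]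
  constructor <;> linarith

theorem isClosed_posSemidef : IsClosed {P : Matrix (Fin n) (Fin n) ℝ | P.PosSemidef} := by
  simp only [posSemidef_iff_dotProduct_mulVec, Matrix.IsHermitian, Set.ofPred_and,
    Set.ofPred_forall, star_trivial]
  refine (isClosed_eq (by fun_prop) (by fun_prop)).inter (isClosed_iInter fun x => ?_)
  exact isClosed_le (by fun_prop) (by fun_prop)

theorem isCompact_posSemidef_trace_le (a : ℝ) :
    IsCompact {P : Matrix (Fin n) (Fin n) ℝ | P.PosSemidef ∧ P.trace ≤ a} := by
  refine (isCompact_Icc (a := -a) (b := a)).matrix.of_isClosed_subset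
    (isClosed_posSemidef.inter
      (isClosed_le (f := fun P : Matrix (Fin n) (Fin n) ℝ => P.trace) (g := fun _ => a)
        (by fun_prop) continuous_const)) ?_
  rintro P ⟨hP, ha⟩ i j
  exact abs_le.mp ((abs_apply_le_trace hP i j).trans ha)

/-- A positive definite quadratic form dominates a multiple of every squared coordinate. -/
theorem exists_sq_apply_le {R : Matrix (Fin m) (Fin m) ℝ} (hR : R.PosDef) :
    ∃ c : ℝ, 0 ≤ c ∧ ∀ (x : Fin m → ℝ) (i : Fin m), x i ^ 2 ≤ c * (x ⬝ᵥ (R *ᵥ x)) := by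
  rcases (Metric.sphere (0 : Fin m → ℝ) 1).eq_empty_or_nonempty with he | hne
  · refine ⟨0, le_rfl, fun x i => ?_⟩
    have hx : x = 0 := by
      by_contra hx
      have hmem : ‖x‖⁻¹ • x ∈ Metric.sphere (0 : Fin m → ℝ) 1 := by
        simp [norm_smul, hx]
      rw [he] at hmem
      exact hmem
    simp [hx]
  · obtain ⟨y, hy, hmin⟩ := (isCompact_sphere (0 : Fin m → ℝ) 1).exists_isMinOn hne
      (f := fun x => x ⬝ᵥ (R *ᵥ x)) (by fun_prop)
    have hy0 : y ≠ 0 := by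
      rintro rfl
      simp at hy
    have hpos := hR.dotProduct_mulVec_pos hy0
    rw [star_trivial] at hpos
    refine ⟨(y ⬝ᵥ (R *ᵥ y))⁻¹, (inv_pos.mpr hpos).le, fun x i => ?_⟩
    by_cases hx : x = 0
    · simp [hx]
    have hxn : 0 < ‖x‖ := norm_pos_iff.mpr hx
    have h1 : y ⬝ᵥ (R *ᵥ y) ≤ (‖x‖⁻¹ • x) ⬝ᵥ (R *ᵥ (‖x‖⁻¹ • x)) :=
      hmin (show ‖x‖⁻¹ • x ∈ Metric.sphere (0 : Fin m → ℝ) 1 by simp [norm_smul, hx])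
    simp only [mulVec_smul, dotProduct_smul, smul_dotProduct, smul_eq_mul] at h1
    have h2 : ‖x‖ ^ 2 * (y ⬝ᵥ (R *ᵥ y)) ≤ x ⬝ᵥ (R *ᵥ x) := by
      calc ‖x‖ ^ 2 * (y ⬝ᵥ (R *ᵥ y)) ≤ ‖x‖ ^ 2 * (‖x‖⁻¹ * (‖x‖⁻¹ * (x ⬝ᵥ (R *ᵥ x)))) := by gcongr
        _ = _ := by field_simp
    have h3 : x i ^ 2 ≤ ‖x‖ ^ 2 := by
      rw [sq_le_sq, abs_norm]
      exact norm_le_pi_norm x i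
    rw [inv_mul_eq_div, le_div_iff₀ hpos]
    exact (mul_le_mul_of_nonneg_right h3 hpos.le).trans h2

theorem exists_sq_apply_le_trace {R : Matrix (Fin m) (Fin m) ℝ} (hR : R.PosDef) :
    ∃ c : ℝ, 0 ≤ c ∧ ∀ (Y : Matrix (Fin m) (Fin n) ℝ) (i : Fin m) (j : Fin n),
      Y i j ^ 2 ≤ c * (Yᵀ * R * Y).trace := by
  obtain ⟨c, hc, h⟩ := exists_sq_apply_le hR
  refine ⟨c, hc, fun Y i j => (h (fun k => Y k j) i).trans (mul_le_mul_of_nonneg_left ?_ hc)⟩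
  have hps : (Yᵀ * R * Y).PosSemidef := by
    simpa [conjTranspose_eq_transpose_of_trivial] using
      hR.posSemidef.conjTranspose_mul_mul_same Y
  have hjj : (fun k => Y k j) ⬝ᵥ (R *ᵥ fun k => Y k j) = (Yᵀ * R * Y) j j := by
    rw [Matrix.mul_assoc]
    simp only [Matrix.mul_apply, dotProduct, mulVec, transpose_apply]
  rw [hjj]
  exact Finset.single_le_sum (f := fun i => (Yᵀ * R * Y) i i) (fun k _ => hps.diag_nonneg)
    (Finset.mem_univ j)

/-- Completing the square in the Lyapunov equation. -/
theorem SolvesLyapunov.complete_square {A : Matrix (Fin n) (Fin n) ℝ}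
    {B : Matrix (Fin n) (Fin m) ℝ} {Q : Matrix (Fin n) (Fin n) ℝ} {R : Matrix (Fin m) (Fin m) ℝ}
    (hR : R.PosDef) {K : Matrix (Fin m) (Fin n) ℝ} {P : Matrix (Fin n) (Fin n) ℝ}
    (hP : P.PosSemidef) (h : SolvesLyapunov A B Q R K P) :
    (K - R⁻¹ * Bᵀ * P)ᵀ * R * (K - R⁻¹ * Bᵀ * P) =
      P * B * R⁻¹ * Bᵀ * P - (P * A + Aᵀ * P + Q) := by
  have hdet : IsUnit R.det := (Matrix.isUnit_iff_isUnit_det _).mp hR.isUnit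
  have hit : (R⁻¹)ᵀ = R⁻¹ := hR.inv.posSemidef.transpose_eq
  have hPt := hP.transpose_eq
  have h1 : (K - R⁻¹ * Bᵀ * P)ᵀ * R = Kᵀ * R - P * B := by
    rw [transpose_sub, transpose_mul, transpose_mul, transpose_transpose, hit, hPt, Matrix.sub_mul,
      Matrix.mul_assoc P, Matrix.mul_assoc B, Matrix.nonsing_inv_mul _ hdet, Matrix.mul_one]
  have h2 : R * (R⁻¹ * Bᵀ * P) = Bᵀ * P := by
    rw [Matrix.mul_assoc, Matrix.mul_nonsing_inv_cancel_left _ _ hdet]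
  have h3 : Kᵀ * R * (R⁻¹ * Bᵀ * P) = Kᵀ * Bᵀ * P := by
    rw [Matrix.mul_assoc, h2, Matrix.mul_assoc]
  rw [SolvesLyapunov] at h
  have hk : Kᵀ * R * K = -(P * (A - B * K) + (A - B * K)ᵀ * P + Q) := by
    rw [eq_neg_iff_add_eq_zero, ← h]
    abel
  rw [h1, Matrix.sub_mul, Matrix.mul_sub, Matrix.mul_sub, h3, hk]
  simp only [transpose_sub, transpose_mul, Matrix.mul_sub, Matrix.sub_mul, Matrix.mul_assoc]
  abel

/-- The sublevel sets of the cost over the stabilizing gains are compact. -/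
theorem isCompact_sublevel {A : Matrix (Fin n) (Fin n) ℝ} {B : Matrix (Fin n) (Fin m) ℝ}
    {Q : Matrix (Fin n) (Fin n) ℝ} {R : Matrix (Fin m) (Fin m) ℝ} (hQ : Q.PosDef) (hR : R.PosDef)
    (a : ℝ) : IsCompact {K | K ∈ stabilizing A B ∧ cost A B Q R K ≤ a} := by
  let D := {P : Matrix (Fin n) (Fin n) ℝ | P.PosSemidef ∧ P.trace ≤ a}
  have hD : IsCompact D := isCompact_posSemidef_trace_le a
  -- The sublevel set is the projection of `T`. Unlike the condition of being stabilizing, the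
  -- equation with `P ⪰ 0` is closed, and it implies stability.
  let T := {p : Matrix (Fin m) (Fin n) ℝ × Matrix (Fin n) (Fin n) ℝ |
    SolvesLyapunov A B Q R p.1 p.2 ∧ p.2 ∈ D}
  have hTc : IsClosed T := by
    refine IsClosed.inter (isClosed_eq (by fun_prop) continuous_const) ?_
    exact hD.isClosed.preimage continuous_snd
  obtain ⟨c, hc, hcR⟩ := exists_sq_apply_le_trace (n := n) hR
  obtain ⟨b, hb⟩ := (hD.image_of_continuousOn (f := fun P : Matrix (Fin n) (Fin n) ℝ =>
    (P * B * R⁻¹ * Bᵀ * P - (P * A + Aᵀ * P + Q)).trace) (by fun_prop)).bddAbove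
  let r := Real.sqrt (c * b)
  have hbox := ((isCompact_Icc (a := -r) (b := r)).matrix (m := Fin m) (n := Fin n)).prod hD
  have hT : IsCompact T := by
    -- The shear undoes `K ↦ K - R⁻¹BᵀP`, the quantity bounded by completing the square.
    refine (hbox.image (f := fun p => (p.1 + R⁻¹ * Bᵀ * p.2, p.2))
      (by fun_prop)).of_isClosed_subset hTc ?_
    rintro ⟨K, P⟩ ⟨hs, hP⟩
    refine ⟨(K - R⁻¹ * Bᵀ * P, P), ⟨fun i j => ?_, hP⟩, by simp⟩
    have h1 := hcR (K - R⁻¹ * Bᵀ * P) i j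
    rw [SolvesLyapunov.complete_square hR hP.1 hs] at h1
    exact abs_le.mp (Real.abs_le_sqrt (h1.trans (mul_le_mul_of_nonneg_left (hb ⟨P, hP, rfl⟩) hc)))
  convert hT.image continuous_fst using 1
  ext K
  constructor
  · rintro ⟨hK, hJ⟩
    exact ⟨(K, lyapunovP A B Q R K), ⟨lyapunovP_spec (existsUnique_solvesLyapunov A B Q R
      (IsHurwitz.lyapunovMap_bijective hK)).exists, (lyapunovP_posDef hQ hR hK).posSemidef, hJ⟩, rfl⟩
  · rintro ⟨⟨K, P⟩, ⟨hs, hP, hJ⟩, rfl⟩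
    have hK := mem_stabilizing_of_solvesLyapunov hQ hR hP hs
    refine ⟨hK, ?_⟩
    rw [cost, lyapunovP_eq (IsHurwitz.lyapunovMap_bijective hK) hs]
    exact hJ

/-! ### Linear growth along a ray -/

/-- Along the ray `K + ρ R⁻¹ Bᵀ P_K` the gains stay stabilizing and the cost grows at most
linearly. -/
theorem cost_ray_le {A : Matrix (Fin n) (Fin n) ℝ} {B : Matrix (Fin n) (Fin m) ℝ}
    {Q : Matrix (Fin n) (Fin n) ℝ} {R : Matrix (Fin m) (Fin m) ℝ} (hQ : Q.PosDef) (hR : R.PosDef)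
    {K : Matrix (Fin m) (Fin n) ℝ} (hK : K ∈ stabilizing A B) {ρ : ℝ} (hρ : 2 ≤ ρ) :
    K + ρ • (R⁻¹ * Bᵀ * lyapunovP A B Q R K) ∈ stabilizing A B ∧
    cost A B Q R (K + ρ • (R⁻¹ * Bᵀ * lyapunovP A B Q R K)) ≤ ρ * cost A B Q R K := by
  have hs := lyapunovP_spec (existsUnique_solvesLyapunov A B Q R
    (IsHurwitz.lyapunovMap_bijective hK)).exists
  have hP := (lyapunovP_posDef hQ hR hK).posSemidef
  rw [cost, cost]
  set P := lyapunovP A B Q R K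
  set G := R⁻¹ * Bᵀ * P with hG
  have hdet : IsUnit R.det := (Matrix.isUnit_iff_isUnit_det _).mp hR.isUnit
  have hRt := hR.posSemidef.transpose_eq
  have hPt := hP.transpose_eq
  have hRG : R * G = Bᵀ * P := by
    rw [hG, Matrix.mul_assoc, Matrix.mul_nonsing_inv_cancel_left _ _ hdet]
  have hPB : P * B = Gᵀ * R := by
    have := congrArg Matrix.transpose hRG
    rw [transpose_mul R G, transpose_mul Bᵀ P, transpose_transpose, hRt, hPt] at this
    exact this.symm
  have hps : ∀ Y : Matrix (Fin m) (Fin n) ℝ, (Yᵀ * R * Y).PosSemidef := fun Y => by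
    simpa [conjTranspose_eq_transpose_of_trivial] using
      hR.posSemidef.conjTranspose_mul_mul_same Y
  have hcl : P * (A - B * (K + ρ • G)) + (A - B * (K + ρ • G))ᵀ * P =
      P * (A - B * K) + (A - B * K)ᵀ * P - (2 * ρ) • (Gᵀ * R * G) := by
    have e1 : P * (B * G) = Gᵀ * R * G := by rw [← Matrix.mul_assoc, hPB]
    have e2 : Gᵀ * (Bᵀ * P) = Gᵀ * R * G := by rw [← hRG, Matrix.mul_assoc]
    simp only [transpose_sub, transpose_mul, transpose_add, transpose_smul, Matrix.mul_sub,
      Matrix.sub_mul, Matrix.mul_add, Matrix.add_mul, Matrix.mul_smul, Matrix.smul_mul, e1,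
      Matrix.mul_assoc _ Bᵀ P, e2, two_mul, add_smul]
    abel
  rw [SolvesLyapunov] at hs
  have hs' : P * (A - B * K) + (A - B * K)ᵀ * P = -(Kᵀ * R * K + Q) := by
    rw [eq_neg_iff_add_eq_zero, ← add_assoc]; exact hs
  have hmem : K + ρ • G ∈ stabilizing A B := by
    refine isHurwitz_of_lyapunov_posDef hP (W := Kᵀ * R * K + (2 * ρ) • (Gᵀ * R * G) + Q)
      (hQ.posSemidef_add ((hps K).add ((hps G).smul (by positivity)))) ?_
    rw [hcl, hs']
    abel
  refine ⟨hmem, ?_⟩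
  have hH : IsHurwitz (A - B * (K + ρ • G)) := hmem
  have ht := lyapunovP_spec (existsUnique_solvesLyapunov A B Q R hH.lyapunovMap_bijective).exists
  set P' := lyapunovP A B Q R (K + ρ • G)
  rw [SolvesLyapunov] at ht
  have ht' : P' * (A - B * (K + ρ • G)) + (A - B * (K + ρ • G))ᵀ * P' =
      -((K + ρ • G)ᵀ * R * (K + ρ • G) + Q) := by
    rw [eq_neg_iff_add_eq_zero, ← add_assoc]; exact ht
  -- This is the surplus of `ρP` in the Lyapunov equation of the new gain; the coefficient `ρ - 2`
  -- is why `ρ ≥ 2` is required.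
  have hW : ((ρ - 1) • Q + (ρ - 2) • (Kᵀ * R * K) +
      (K - ρ • G)ᵀ * R * (K - ρ • G)).PosSemidef :=
    ((hQ.posSemidef.smul (by linarith)).add ((hps K).smul (by linarith))).add (hps _)
  have hdiff := hH.posSemidef_of_lyapunov (P := ρ • P - P') hW (by
    have e : (ρ • P - P') * (A - B * (K + ρ • G)) + (A - B * (K + ρ • G))ᵀ * (ρ • P - P') =
        ρ • (P * (A - B * (K + ρ • G)) + (A - B * (K + ρ • G))ᵀ * P) -
        (P' * (A - B * (K + ρ • G)) + (A - B * (K + ρ • G))ᵀ * P') := by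
      simp only [sub_mul (ρ • P), mul_sub _ (ρ • P), Matrix.smul_mul, Matrix.mul_smul, smul_add]
      abel
    rw [e, hcl, hs', ht']
    simp only [transpose_sub, transpose_add, transpose_smul, Matrix.mul_sub, Matrix.sub_mul,
      Matrix.mul_add, Matrix.add_mul, Matrix.smul_mul, Matrix.mul_smul]
    module)
  have := hdiff.trace_nonneg
  rw [trace_sub, trace_smul, smul_eq_mul] at this
  linarith

/-! ### Frobenius norm and gradient -/

theorem frobeniusNorm_eq_norm (M : Matrix (Fin m) (Fin n) ℝ) :
    frobeniusNorm M = ‖(WithLp.toLp 2 fun p : Fin m × Fin n => M p.1 p.2 :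
      EuclideanSpace ℝ (Fin m × Fin n))‖ := by
  rw [EuclideanSpace.norm_eq, frobeniusNorm, Fintype.sum_prod_type]
  simp

theorem frobeniusNorm_nonneg (M : Matrix (Fin m) (Fin n) ℝ) : 0 ≤ frobeniusNorm M :=
  Real.sqrt_nonneg _

theorem frobeniusNorm_sq (M : Matrix (Fin m) (Fin n) ℝ) :
    frobeniusNorm M ^ 2 = ∑ i, ∑ j, M i j ^ 2 :=
  Real.sq_sqrt (Finset.sum_nonneg fun _ _ => Finset.sum_nonneg fun _ _ => sq_nonneg _)

theorem frobeniusNorm_add_le (M N : Matrix (Fin m) (Fin n) ℝ) :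
    frobeniusNorm (M + N) ≤ frobeniusNorm M + frobeniusNorm N := by
  simp only [frobeniusNorm_eq_norm]
  exact norm_add_le (WithLp.toLp 2 fun p : Fin m × Fin n => M p.1 p.2 :
    EuclideanSpace ℝ (Fin m × Fin n)) (WithLp.toLp 2 fun p => N p.1 p.2)

theorem frobeniusNorm_smul (c : ℝ) (M : Matrix (Fin m) (Fin n) ℝ) :
    frobeniusNorm (c • M) = |c| * frobeniusNorm M := by
  simp only [frobeniusNorm_eq_norm, ← Real.norm_eq_abs, ← norm_smul]
  rfl

theorem frobeniusNorm_neg (M : Matrix (Fin m) (Fin n) ℝ) :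
    frobeniusNorm (-M) = frobeniusNorm M := by
  simp [frobeniusNorm]

theorem frobeniusNorm_pos {M : Matrix (Fin m) (Fin n) ℝ} (hM : M ≠ 0) : 0 < frobeniusNorm M := by
  rw [frobeniusNorm_eq_norm, norm_pos_iff]
  intro h
  apply hM
  ext i j
  exact congrFun (congrArg WithLp.ofLp h) (i, j)

theorem continuous_frobeniusNorm :
    Continuous (frobeniusNorm : Matrix (Fin m) (Fin n) ℝ → ℝ) := by
  unfold frobeniusNorm
  fun_prop

theorem fderiv_neg_matrixGradient (f : Matrix (Fin m) (Fin n) ℝ → ℝ)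
    (K : Matrix (Fin m) (Fin n) ℝ) :
    fderiv ℝ f K (-matrixGradient f K) = -frobeniusNorm (matrixGradient f K) ^ 2 := by
  rw [map_neg, frobeniusNorm_sq]
  conv_lhs => rw [matrix_eq_sum_single (matrixGradient f K)]
  simp only [map_sum]
  congr 1
  refine Finset.sum_congr rfl fun i _ => Finset.sum_congr rfl fun j _ => ?_
  have : single i j (matrixGradient f K i j) = matrixGradient f K i j • single i j (1 : ℝ) := by
    rw [smul_single, smul_eq_mul, mul_one]
  rw [this, map_smul, smul_eq_mul, sq]
  rfl

theorem hasDerivAt_line {f : Matrix (Fin m) (Fin n) ℝ → ℝ} {K : Matrix (Fin m) (Fin n) ℝ}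
    (hf : DifferentiableAt ℝ f K) (H : Matrix (Fin m) (Fin n) ℝ) :
    HasDerivAt (fun t : ℝ => f (K + t • H)) (fderiv ℝ f K H) 0 :=
  HasFDerivAt.hasLineDerivAt (E := Fin m → Fin n → ℝ) hf.hasFDerivAt H

/-! ### From a PL inequality to quadratic growth -/

/-- If `√(J - a) + c ‖· - K₁‖` is minimal at a point where `J > a`, then the gradient of `J` there
is at most `2 c √(J - a)`. -/
theorem frobeniusNorm_matrixGradient_le {J : Matrix (Fin m) (Fin n) ℝ → ℝ}
    {K K₁ : Matrix (Fin m) (Fin n) ℝ} {a c : ℝ} (hJ : DifferentiableAt ℝ J K) (ha : a < J K)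
    (hc : 0 ≤ c)
    (hmin : ∀ᶠ K' in 𝓝 K, Real.sqrt (J K - a) + c * frobeniusNorm (K - K₁) ≤
      Real.sqrt (J K' - a) + c * frobeniusNorm (K' - K₁)) :
    frobeniusNorm (matrixGradient J K) ≤ 2 * c * Real.sqrt (J K - a) := by
  set g := frobeniusNorm (matrixGradient J K) with hg
  set H := -matrixGradient J K with hH
  have hpos : 0 < Real.sqrt (J K - a) := Real.sqrt_pos.mpr (sub_pos.mpr ha)
  -- Move along the negative gradient. Replacing the penalty's increase by its upper bound `t c g`
  -- keeps the function differentiable even where the norm is not.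
  have hd : HasDerivAt (fun t : ℝ => Real.sqrt (J (K + t • H) - a) + t * (c * g))
      (-g ^ 2 / (2 * Real.sqrt (J K - a)) + c * g) 0 := by
    have h1 := (hasDerivAt_line hJ H).sub_const a
    rw [hH, fderiv_neg_matrixGradient, ← hH] at h1
    have h2 := h1.sqrt (by simpa using (sub_pos.mpr ha).ne')
    have h3 := (hasDerivAt_id (0 : ℝ)).mul_const (c * g)
    have h4 := h2.fun_add h3
    simp only [zero_smul, add_zero, id_eq, one_mul] at h4
    exact h4
  have hcont : Tendsto (fun t : ℝ => K + t • H) (𝓝[>] 0) (𝓝 K) := by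
    have : Continuous fun t : ℝ => K + t • H := by fun_prop
    have h := this.tendsto 0
    simp only [zero_smul, add_zero] at h
    exact h.mono_left nhdsWithin_le_nhds
  have hnn : 0 ≤ -g ^ 2 / (2 * Real.sqrt (J K - a)) + c * g := by
    refine ge_of_tendsto hd.tendsto_slope_zero_right ?_
    filter_upwards [hcont.eventually hmin, self_mem_nhdsWithin] with t ht ht0
    have ht0' : (0 : ℝ) < t := ht0
    have htri : frobeniusNorm (K + t • H - K₁) ≤ frobeniusNorm (K - K₁) + t * g := by
      have := frobeniusNorm_add_le (K - K₁) (t • H)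
      rw [frobeniusNorm_smul, abs_of_pos ht0', hH, frobeniusNorm_neg, ← hH] at this
      rwa [add_sub_right_comm]
    have := mul_le_mul_of_nonneg_left htri hc
    simp only [zero_add, zero_smul, add_zero, zero_mul, smul_eq_mul]
    refine mul_nonneg (inv_pos.mpr ht0').le ?_
    nlinarith
  rcases (frobeniusNorm_nonneg (matrixGradient J K)).eq_or_lt with h0 | h0
  · rw [hg, ← h0]
    positivity
  · rw [← hg] at h0
    have h4 : g ^ 2 / (2 * Real.sqrt (J K - a)) ≤ c * g := by
      rw [neg_div] at hnn
      linarith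
    rw [div_le_iff₀ (by positivity)] at h4
    nlinarith

/-- Under a Polyak–Łojasiewicz inequality relative to a lower bound `a` of the cost, every
stabilizing gain has a gain of cost `a` within distance `4 √(J - a) / √μ`. -/
theorem exists_near_of_polyakLojasiewicz {A : Matrix (Fin n) (Fin n) ℝ}
    {B : Matrix (Fin n) (Fin m) ℝ} {Q : Matrix (Fin n) (Fin n) ℝ} {R : Matrix (Fin m) (Fin m) ℝ}
    (hQ : Q.PosDef) (hR : R.PosDef) {a μ : ℝ} (ha : ∀ K ∈ stabilizing A B, a ≤ cost A B Q R K)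
    (hμ : 0 < μ)
    (hPL : ∀ K ∈ stabilizing A B, frobeniusNorm (matrixGradient (cost A B Q R) K) ≥
      Real.sqrt (μ * (cost A B Q R K - a)))
    {K₁ : Matrix (Fin m) (Fin n) ℝ} (hK₁ : K₁ ∈ stabilizing A B) :
    ∃ K ∈ stabilizing A B, cost A B Q R K = a ∧
      Real.sqrt μ / 4 * frobeniusNorm (K - K₁) ≤ Real.sqrt (cost A B Q R K₁ - a) := by
  set J := cost A B Q R
  set c := Real.sqrt μ / 4 with hc
  have hsμ : 0 < Real.sqrt μ := Real.sqrt_pos.mpr hμ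
  have hc0 : 0 < c := by positivity
  let Φ := fun K => Real.sqrt (J K - a) + c * frobeniusNorm (K - K₁)
  have hΦ₁ : Φ K₁ = Real.sqrt (J K₁ - a) := by
    simp [Φ, frobeniusNorm]
  have hcont : ContinuousOn Φ {K | K ∈ stabilizing A B ∧ J K ≤ J K₁} := by
    intro K hK
    have h1 : ContinuousAt J K :=
      (differentiableAt_cost A B Q R hK.1).continuousAt
    have h2 : ContinuousAt (fun K' => c * frobeniusNorm (K' - K₁)) K :=
      (continuous_const.mul
        (continuous_frobeniusNorm.comp (continuous_id.sub continuous_const))).continuousAt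
    exact ((h1.sub continuousAt_const).sqrt.add h2).continuousWithinAt
  obtain ⟨K, hK, hmin⟩ := (isCompact_sublevel hQ hR (J K₁)).exists_isMinOn ⟨K₁, hK₁, le_rfl⟩ hcont
  -- Outside the sublevel set, `√(J - a)` alone is already at least `Φ K₁`.
  have hglob : ∀ K' ∈ stabilizing A B, Φ K ≤ Φ K' := by
    intro K' hK'
    by_cases h : J K' ≤ J K₁
    · exact hmin ⟨hK', h⟩
    · push Not at h
      have h1 : Φ K ≤ Φ K₁ := hmin ⟨hK₁, le_rfl⟩
      have h2 : Real.sqrt (J K₁ - a) ≤ Real.sqrt (J K' - a) := Real.sqrt_le_sqrt (by linarith)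
      have h3 : 0 ≤ c * frobeniusNorm (K' - K₁) :=
        mul_nonneg hc0.le (frobeniusNorm_nonneg _)
      have h4 : Φ K' = Real.sqrt (J K' - a) + c * frobeniusNorm (K' - K₁) := rfl
      linarith
  have hJK : J K = a := by
    by_contra hne
    have hlt : a < J K := lt_of_le_of_ne (ha K hK.1) (Ne.symm hne)
    -- Since `2c = √μ / 2 < √μ`, this bound contradicts PL.
    have h1 := frobeniusNorm_matrixGradient_le (differentiableAt_cost A B Q R hK.1) hlt hc0.le
      ((eventually_mem_stabilizing hK.1).mono hglob)
    have h2 := hPL K hK.1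
    rw [Real.sqrt_mul hμ.le] at h2
    have h3 : 0 < Real.sqrt (J K - a) := Real.sqrt_pos.mpr (sub_pos.mpr hlt)
    have h4 : Real.sqrt μ * Real.sqrt (J K - a) ≤ 2 * c * Real.sqrt (J K - a) := h2.trans h1
    have h5 : 0 < Real.sqrt μ * Real.sqrt (J K - a) := mul_pos hsμ h3
    rw [hc] at h4
    linarith
  refine ⟨K, hK.1, hJK, ?_⟩
  have h1 := hglob K₁ hK₁
  rw [hΦ₁] at h1
  refine le_trans ?_ h1
  exact le_add_of_nonneg_left (Real.sqrt_nonneg _)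

/-! ### Quadratic against linear growth -/

/-- The cost satisfies no Polyak–Łojasiewicz inequality relative to a lower bound. -/
theorem not_polyakLojasiewicz (hn : 0 < n) {A : Matrix (Fin n) (Fin n) ℝ}
    {B : Matrix (Fin n) (Fin m) ℝ} {Q : Matrix (Fin n) (Fin n) ℝ} {R : Matrix (Fin m) (Fin m) ℝ}
    (hAB : IsControllable A B) (hQ : Q.PosDef) (hR : R.PosDef) {a : ℝ}
    (ha : ∀ K ∈ stabilizing A B, a ≤ cost A B Q R K) :
    ¬ ∃ μ : ℝ, 0 < μ ∧ ∀ K ∈ stabilizing A B,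
      frobeniusNorm (matrixGradient (cost A B Q R) K) ≥
        Real.sqrt (μ * (cost A B Q R K - a)) := by
  rintro ⟨μ, hμ, hPL⟩
  obtain ⟨K₀, hK₀⟩ := hAB.stabilizing_nonempty
  have hB : B ≠ 0 := by
    rintro rfl
    have h1 := hAB.eq_zero (x := fun _ => 1) (fun k => by simp)
    exact one_ne_zero (congrFun h1 ⟨0, hn⟩)
  have hG : R⁻¹ * Bᵀ * lyapunovP A B Q R K₀ ≠ 0 := by
    intro h
    apply hB
    have hP := (Matrix.isUnit_iff_isUnit_det _).mp (lyapunovP_posDef hQ hR hK₀).isUnit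
    have hRd := (Matrix.isUnit_iff_isUnit_det _).mp hR.isUnit
    have h1 : R * (R⁻¹ * Bᵀ * lyapunovP A B Q R K₀) * (lyapunovP A B Q R K₀)⁻¹ = Bᵀ := by
      rw [Matrix.mul_assoc R⁻¹, Matrix.mul_nonsing_inv_cancel_left _ _ hRd,
        Matrix.mul_nonsing_inv_cancel_right _ _ hP]
    rw [h, Matrix.mul_zero, Matrix.zero_mul] at h1
    rw [← transpose_transpose B, ← h1, transpose_zero]
  set G := R⁻¹ * Bᵀ * lyapunovP A B Q R K₀
  set g := frobeniusNorm G
  have hg : 0 < g := frobeniusNorm_pos hG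
  set c := Real.sqrt μ / 4
  have hc : 0 < c := div_pos (Real.sqrt_pos.mpr hμ) (by norm_num)
  set p := cost A B Q R K₀
  have hp : 0 ≤ p := (lyapunovP_posDef hQ hR hK₀).posSemidef.trace_nonneg
  obtain ⟨C, hC⟩ := ((isCompact_sublevel (A := A) (B := B) hQ hR a).image
    continuous_frobeniusNorm).bddAbove
  set D := |C| + frobeniusNorm K₀
  have hD : 0 ≤ D := add_nonneg (abs_nonneg _) (frobeniusNorm_nonneg _)
  -- The first term allows `cost_ray_le`, the second gives `ρg - D ≥ ρg / 2`, and the third makes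
  -- `(cρg / 2)²` exceed `ρ(p + |a|)`; the summand `2` makes that strict.
  set ρ := 2 + 2 * D / g + 4 * (p + |a|) / (c ^ 2 * g ^ 2) with hρ
  have hρ2 : 2 ≤ ρ := by
    have : 0 ≤ 2 * D / g := by positivity
    have : 0 ≤ 4 * (p + |a|) / (c ^ 2 * g ^ 2) := by positivity
    linarith
  obtain ⟨hmem, hcost⟩ := cost_ray_le hQ hR hK₀ hρ2
  obtain ⟨K, hK, hKa, hdist⟩ := exists_near_of_polyakLojasiewicz hQ hR ha hμ hPL hmem
  have hKC : frobeniusNorm K ≤ |C| := (hC ⟨K, ⟨hK, hKa.le⟩, rfl⟩).trans (le_abs_self C)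
  have hfar : ρ * g - D ≤ frobeniusNorm (K - (K₀ + ρ • G)) := by
    have h1 := frobeniusNorm_add_le (K + -(K - (K₀ + ρ • G))) (-K₀)
    have h2 := frobeniusNorm_add_le K (-(K - (K₀ + ρ • G)))
    have h3 : K + -(K - (K₀ + ρ • G)) + -K₀ = ρ • G := by abel
    rw [h3, frobeniusNorm_smul, abs_of_pos (by linarith), frobeniusNorm_neg K₀] at h1
    rw [frobeniusNorm_neg] at h2
    linarith
  have hDρ : 2 * D ≤ ρ * g := by
    have h1 : 2 * D / g ≤ ρ := by
      have : 0 ≤ 4 * (p + |a|) / (c ^ 2 * g ^ 2) := by positivity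
      linarith
    rwa [div_le_iff₀ hg] at h1
  have hlow : c * (ρ * g / 2) ≤ Real.sqrt (ρ * p + |a|) := by
    calc c * (ρ * g / 2) ≤ c * frobeniusNorm (K - (K₀ + ρ • G)) := by
          gcongr
          linarith
      _ ≤ _ := hdist
      _ ≤ _ := Real.sqrt_le_sqrt (by linarith [neg_abs_le a])
  have hsq : (c * (ρ * g / 2)) ^ 2 ≤ ρ * p + |a| := by
    rw [← Real.sq_sqrt (show 0 ≤ ρ * p + |a| by positivity)]
    exact pow_le_pow_left₀ (by positivity) hlow 2
  have hbig : 4 * (p + |a|) < ρ * (c ^ 2 * g ^ 2) := by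
    rw [← div_lt_iff₀ (by positivity)]
    have : 0 ≤ 2 * D / g := by positivity
    linarith
  have h1 : ρ * (4 * (p + |a|)) < ρ * (ρ * (c ^ 2 * g ^ 2)) :=
    mul_lt_mul_of_pos_left hbig (by linarith)
  have h2 : |a| ≤ ρ * |a| := le_mul_of_one_le_left (abs_nonneg a) (by linarith)
  nlinarith

end CTLQR

theorem mainTheorem1 {n m : ℕ} (hn : 0 < n)
    (A : Matrix (Fin n) (Fin n) ℝ) (B : Matrix (Fin n) (Fin m) ℝ)
    (Q : Matrix (Fin n) (Fin n) ℝ) (R : Matrix (Fin m) (Fin m) ℝ)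
    (hAB : CTLQR.IsControllable A B) (hQ : Q.PosDef) (hR : R.PosDef) :
    -- `P_K` is well defined and `J` is differentiable at every stabilizing gain
    (∀ K ∈ CTLQR.stabilizing A B, ∃! P, CTLQR.SolvesLyapunov A B Q R K P) ∧
    (∀ K ∈ CTLQR.stabilizing A B, DifferentiableAt ℝ (CTLQR.cost A B Q R) K) ∧
    -- no global PL inequality relative to the infimum of `J` over the stabilizing gains
    (¬ ∃ μ : ℝ, 0 < μ ∧ ∀ K ∈ CTLQR.stabilizing A B,
      CTLQR.frobeniusNorm (CTLQR.matrixGradient (CTLQR.cost A B Q R) K) ≥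
        Real.sqrt (μ * (CTLQR.cost A B Q R K -
          sInf (CTLQR.cost A B Q R '' CTLQR.stabilizing A B)))) ∧
    -- the same with `J(K*)` for a minimizer `K*`
    (∀ Kstar ∈ CTLQR.stabilizing A B,
      IsMinOn (CTLQR.cost A B Q R) (CTLQR.stabilizing A B) Kstar →
      ¬ ∃ μ : ℝ, 0 < μ ∧ ∀ K ∈ CTLQR.stabilizing A B,
        CTLQR.frobeniusNorm (CTLQR.matrixGradient (CTLQR.cost A B Q R) K) ≥
          Real.sqrt (μ * (CTLQR.cost A B Q R K - CTLQR.cost A B Q R Kstar))) := by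
  refine ⟨fun K hK => CTLQR.existsUnique_solvesLyapunov A B Q R
      (CTLQR.IsHurwitz.lyapunovMap_bijective hK),
    fun K hK => CTLQR.differentiableAt_cost A B Q R hK,
    CTLQR.not_polyakLojasiewicz hn hAB hQ hR fun K hK => csInf_le ⟨0, ?_⟩ ⟨K, hK, rfl⟩,
    fun Kstar _ hmin => CTLQR.not_polyakLojasiewicz hn hAB hQ hR fun K hK => hmin hK⟩
  rintro _ ⟨K', hK', rfl⟩
  exact (CTLQR.lyapunovP_posDef hQ hR hK').posSemidef.trace_nonneg
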